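/- Let $R$ be a (commutative) Noetherian local ring, $I$ an ideal of $R$, and $M, N$ finitely generated $R$-modules. For $j \geq 0$ let $$H^j_I(M,N) = \varinjlim_{n} \operatorname{Ext}^j_R(M/I^nM, N)$$ be the $j$-th generalized local cohomology module of $M$ and $N$ with respect to $I$, where the transition maps are induced by the canonical surjections $M/I^{b}M \to M/I^{a}M$ for $a \leq b$. Then for every $i \in \mathbb{N} \cup \{\infty\}$, $$\bigcup_{j<i} \operatorname{Supp}_R H^j_I(M,N) = \bigcup_{j<i} \operatorname{Supp}_R \operatorname{Ext}^j_R(M/IM, N),$$ where $j$ runs over the integers with $0 \leq j < i$. -/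

import Mathlib

universe u v

namespace GenLocCoh

open CategoryTheory

noncomputable section

/-- `Ext^j_R(M, N)` for two modules `M`, `N` over a commutative ring `R`, as an `R`-module. -/
abbrev ExtMod (R : Type u) [CommRing R] [Small.{v} R] (M N : Type v)
    [AddCommGroup M] [Module R M] [AddCommGroup N] [Module R N] (j : ℕ) : Type v :=
  Abelian.Ext (ModuleCat.of R M) (ModuleCat.of R N) j

/-- The `R`-linear map `Ext^j_R(M', N) → Ext^j_R(M, N)` induced by an `R`-linear map
`f : M → M'`. -/
abbrev ExtMod.precomp {R : Type u} [CommRing R] [Small.{v} R] {M M' : Type v}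
    [AddCommGroup M] [Module R M] [AddCommGroup M'] [Module R M'] (f : M →ₗ[R] M')
    (N : Type v) [AddCommGroup N] [Module R N] (j : ℕ) :
    ExtMod R M' N j →ₗ[R] ExtMod R M N j :=
  (Abelian.Ext.mk₀ (ModuleCat.ofHom f)).precompOfLinear R (ModuleCat.of R N) (zero_add j)

section

variable {R : Type u} [CommRing R] (I : Ideal R) (M N : Type v)
  [AddCommGroup M] [Module R M] [AddCommGroup N] [Module R N]

/-- The canonical surjection `M / I^b M → M / I^a M` for `a ≤ b`. -/
def powProj {a b : ℕ} (h : a ≤ b) :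
    (M ⧸ (I ^ b • ⊤ : Submodule R M)) →ₗ[R] (M ⧸ (I ^ a • ⊤ : Submodule R M)) :=
  Submodule.factor (Submodule.smul_mono_left (Ideal.pow_le_pow_right h))

lemma powProj_refl (a : ℕ) : powProj I M (le_refl a) = LinearMap.id := by
  ext x
  simp [powProj]

lemma powProj_comp {a b c : ℕ} (h : a ≤ b) (h' : b ≤ c) :
    powProj I M h ∘ₗ powProj I M h' = powProj I M (h.trans h') := by
  ext x
  simp [powProj]

variable [Small.{v} R]

/-- The transition map `Ext^j_R(M / I^a M, N) → Ext^j_R(M / I^b M, N)` for `a ≤ b`, induced by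
the canonical surjection `M / I^b M → M / I^a M`. -/
def extTransition (j a b : ℕ) (h : a ≤ b) :
    ExtMod R (M ⧸ (I ^ a • ⊤ : Submodule R M)) N j →ₗ[R]
      ExtMod R (M ⧸ (I ^ b • ⊤ : Submodule R M)) N j :=
  ExtMod.precomp (powProj I M h) N j

/-- The modules `Ext^j_R(M / I^n M, N)` with these transition maps form a directed system. -/
instance extDirectedSystem (j : ℕ) :
    DirectedSystem (fun n : ℕ => ExtMod R (M ⧸ (I ^ n • ⊤ : Submodule R M)) N j)
      (fun a b h => extTransition I M N j a b h) where
  map_self a x := by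
    simp [extTransition, powProj_refl]
  map_map a b c h h' x := by
    simp only [extTransition, Abelian.Ext.bilinearCompOfLinear_apply_apply,
      Abelian.Ext.mk₀_comp_mk₀_assoc, ← ModuleCat.ofHom_comp, powProj_comp]

/-- The generalized local cohomology module
`H^j_I(M, N) = lim_{n} Ext^j_R(M / I^n M, N)` (direct limit). -/
abbrev genLocalCohomology (j : ℕ) : Type v :=
  Module.DirectLimit (fun n : ℕ => ExtMod R (M ⧸ (I ^ n • ⊤ : Submodule R M)) N j)
    (extTransition I M N j)

end

end

end GenLocCoh

/-! Fix a prime `p`; vanishing means vanishing after localizing at `p`. The key fact is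
`ExtMod.notMem_support_of_support_subset`: vanishing of `Ext^k(K, N)` for `k ≤ j` passes to every
finite `X` with `Supp X ⊆ Supp K`. By prime filtrations one may take `X = R/q` with `q ∈ Supp K`. A
nonzero map `K → R/q` then reduces the claim to its kernel in lower degrees and to its cokernel,
which is killed by an ideal larger than `q`.

With `K = M/IM` and `X = M/I^nM`, vanishing of the Ext modules passes to the limit. Conversely, if
`Ext^k(M/IM, N)` vanishes for `k < j`, so does `Ext^k` of the kernel of `M/I^nM → M/IM`. Hence,
locally at `p`, `Ext^j(M/IM, N)` injects into every `Ext^j(M/I^nM, N)` with `n ≥ 1`, and so into the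
limit. -/

theorem Ideal.isLocalizedModule_residueField {R : Type*} [CommRing R] (q : Ideal R) [q.IsPrime] :
    IsLocalizedModule q.primeCompl
      (IsScalarTower.toAlgHom R (R ⧸ q) q.ResidueField).toLinearMap where
  map_units s := by
    have hs : algebraMap R q.ResidueField s ≠ 0 := by
      rw [Ne, Ideal.algebraMap_residueField_eq_zero]
      exact s.2
    rw [Module.End.isUnit_iff]
    refine ⟨fun x y h ↦ ?_, fun y ↦ ⟨(algebraMap R q.ResidueField s)⁻¹ * y, ?_⟩⟩
    · rw [Module.algebraMap_end_apply, Module.algebraMap_end_apply, Algebra.smul_def,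
        Algebra.smul_def] at h
      exact mul_left_cancel₀ hs h
    · rw [Module.algebraMap_end_apply, Algebra.smul_def, mul_inv_cancel_left₀ hs]
  surj y := by
    obtain ⟨⟨x, s⟩, h⟩ := IsLocalization.surj (nonZeroDivisors (R ⧸ q)) y
    obtain ⟨r, hr⟩ := Ideal.Quotient.mk_surjective (s : R ⧸ q)
    refine ⟨⟨x, ⟨r, fun hrq ↦ nonZeroDivisors.coe_ne_zero s ?_⟩⟩, ?_⟩
    · rw [← hr, Ideal.Quotient.eq_zero_iff_mem]
      exact hrq
    · rw [← hr, Ideal.algebraMap_quotient_residueField_mk, mul_comm] at h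
      simpa [Algebra.smul_def, Submonoid.smul_def] using h
  exists_of_eq {x y} h :=
    ⟨1, by simpa using q.injective_algebraMap_quotient_residueField h⟩

-- The fibre of `K` at `q` is a nonzero vector space, so it has a nonzero functional. This gives a
-- nonzero map from `K` to the residue field, whose denominators can be cleared because `K` is
-- finitely presented.
open TensorProduct in
theorem Module.exists_hom_quotient_ne_zero_of_mem_support {R K : Type*} [CommRing R]
    [AddCommGroup K] [Module R K] [Module.FinitePresentation R K] {q : PrimeSpectrum R}
    (hq : q ∈ Module.support R K) : ∃ f : K →ₗ[R] R ⧸ q.asIdeal, f ≠ 0 := by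
  rw [Module.mem_support_iff_nontrivial_residueField_tensorProduct] at hq
  obtain ⟨z, hz⟩ := exists_ne (0 : q.asIdeal.ResidueField ⊗[R] K)
  obtain ⟨φ, hφ⟩ : ∃ φ : Module.Dual q.asIdeal.ResidueField
      (q.asIdeal.ResidueField ⊗[R] K), φ z ≠ 0 := by
    by_contra! h
    exact hz ((Module.forall_dual_apply_eq_zero_iff _ z).1 h)
  let g : K →ₗ[R] q.asIdeal.ResidueField :=
    φ.restrictScalars R ∘ₗ TensorProduct.mk R q.asIdeal.ResidueField K 1
  have hg : g ≠ 0 := by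
    intro h
    apply hφ
    suffices φ = 0 by simp [this]
    ext k
    exact LinearMap.congr_fun h k
  have := q.asIdeal.isLocalizedModule_residueField
  obtain ⟨f, s, hf⟩ := Module.FinitePresentation.exists_lift_of_isLocalizedModule
    q.asIdeal.primeCompl
    (IsScalarTower.toAlgHom R (R ⧸ q.asIdeal) q.asIdeal.ResidueField).toLinearMap g
  refine ⟨f, fun h0 ↦ hg ?_⟩
  ext k
  have hk := LinearMap.congr_fun hf k
  have hs : algebraMap R q.asIdeal.ResidueField s ≠ 0 := by
    rw [Ne, Ideal.algebraMap_residueField_eq_zero]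
    exact s.2
  rw [h0, LinearMap.comp_zero, LinearMap.zero_apply, LinearMap.smul_apply, Submonoid.smul_def,
    Algebra.smul_def] at hk
  exact (mul_eq_zero.1 hk.symm).resolve_left hs

namespace GenLocCoh

open CategoryTheory

/-! ### Long exact Ext sequences at a prime -/

section ShortExact

variable {R : Type u} [CommRing R] [Small.{v} R] {A B C : Type v}
  [AddCommGroup A] [Module R A] [AddCommGroup B] [Module R B] [AddCommGroup C] [Module R C]
  {f : A →ₗ[R] B} {g : B →ₗ[R] C} (hf : Function.Injective f) (hg : Function.Surjective g)
  (hfg : Function.Exact f g) (N : Type v) [AddCommGroup N] [Module R N]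

include hf hg hfg

omit [Small.{v} R] in
theorem shortExact_moduleCat :
    (ShortComplex.mk (ModuleCat.ofHom f) (ModuleCat.ofHom g) (by
      ext x; exact hfg.apply_apply_eq_zero x)).ShortExact where
  exact := (ShortComplex.ShortExact.moduleCat_exact_iff_function_exact _).mpr hfg
  mono_f := (ModuleCat.mono_iff_injective _).mpr hf
  epi_g := (ModuleCat.epi_iff_surjective _).mpr hg

theorem ExtMod.precomp_exact (j : ℕ) :
    Function.Exact (ExtMod.precomp g N j) (ExtMod.precomp f N j) := by
  have h := Abelian.Ext.contravariant_sequence_exact₂' (shortExact_moduleCat hf hg hfg)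
    (ModuleCat.of R N) j
  rw [ShortComplex.ab_exact_iff_function_exact] at h
  exact h

/-- The connecting maps of the long exact sequence of `Ext(-, N)`. -/
theorem ExtMod.exists_connecting (j : ℕ) :
    ∃ δ : ExtMod R A N j →ₗ[R] ExtMod R C N (j + 1),
      Function.Exact δ (ExtMod.precomp g N (j + 1)) := by
  have hS := shortExact_moduleCat hf hg hfg
  refine ⟨hS.extClass.precompOfLinear R (ModuleCat.of R N) (add_comm 1 j), ?_⟩
  have h := Abelian.Ext.contravariant_sequence_exact₃' hS (ModuleCat.of R N) j (j + 1)
    (add_comm 1 j)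
  rw [ShortComplex.ab_exact_iff_function_exact] at h
  exact h

/-- If `Ext^k(A, N)` vanishes at `p` for all `k < j`, then an element of `Ext^j(C, N)` which
dies in `Ext^j(B, N)` is zero at `p`. -/
theorem ExtMod.exists_smul_eq_zero_of_precomp_eq_zero {p : PrimeSpectrum R} {j : ℕ}
    (hA : ∀ k < j, p ∉ Module.support R (ExtMod R A N k)) {x : ExtMod R C N j}
    (hx : ExtMod.precomp g N j x = 0) : ∃ r ∉ p.asIdeal, r • x = 0 := by
  cases j with
  | zero =>
    -- No connecting map enters degree 0; `Hom(-, N)` turns the epimorphism into an injection.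
    have : Epi (ModuleCat.ofHom g) := (ModuleCat.epi_iff_surjective _).mpr hg
    refine ⟨1, p.asIdeal.one_notMem, ?_⟩
    rw [one_smul]
    apply Abelian.Ext.precomp_mk₀_injective_of_epi (ModuleCat.of R N) (ModuleCat.ofHom g)
    rw [map_zero]
    exact hx
  | succ k =>
    obtain ⟨δ, hδ⟩ := ExtMod.exists_connecting hf hg hfg N k
    obtain ⟨y, rfl⟩ := (hδ x).1 hx
    obtain ⟨r, hr, hry⟩ := Module.notMem_support_iff'.1 (hA k k.lt_succ_self) y
    exact ⟨r, hr, by rw [← map_smul, hry, map_zero]⟩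

theorem ExtMod.notMem_support_right {p : PrimeSpectrum R} {j : ℕ}
    (hA : ∀ k < j, p ∉ Module.support R (ExtMod R A N k))
    (hB : p ∉ Module.support R (ExtMod R B N j)) : p ∉ Module.support R (ExtMod R C N j) := by
  rw [Module.notMem_support_iff'] at hB ⊢
  intro x
  obtain ⟨r, hr, hrx⟩ := hB (ExtMod.precomp g N j x)
  rw [← map_smul] at hrx
  obtain ⟨s, hs, hsx⟩ := ExtMod.exists_smul_eq_zero_of_precomp_eq_zero hf hg hfg N hA hrx
  exact ⟨s * r, p.asIdeal.primeCompl.mul_mem hs hr, by rwa [mul_smul]⟩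

theorem ExtMod.notMem_support_middle {p : PrimeSpectrum R} {j : ℕ}
    (hA : p ∉ Module.support R (ExtMod R A N j))
    (hC : p ∉ Module.support R (ExtMod R C N j)) : p ∉ Module.support R (ExtMod R B N j) := by
  rw [Module.notMem_support_iff'] at hA hC ⊢
  intro x
  obtain ⟨r, hr, hrx⟩ := hA (ExtMod.precomp f N j x)
  rw [← map_smul] at hrx
  obtain ⟨y, hy⟩ := (ExtMod.precomp_exact hf hg hfg N j _).1 hrx
  obtain ⟨s, hs, hsy⟩ := hC y
  exact ⟨s * r, p.asIdeal.primeCompl.mul_mem hs hr, by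
    rw [mul_smul, ← hy, ← map_smul, hsy, map_zero]⟩

end ShortExact

/-! ### Comparing Ext over modules with nested supports -/

section Noetherian

variable {R : Type u} [CommRing R] [IsNoetherianRing R] [Small.{v} R]
  (K N : Type v) [AddCommGroup K] [Module R K] [Module.Finite R K] [AddCommGroup N] [Module R N]

omit [IsNoetherianRing R] in
theorem ExtMod.notMem_support_of_subsingleton (X : Type v) [AddCommGroup X] [Module R X]
    [Subsingleton X] (p : PrimeSpectrum R) (j : ℕ) :
    p ∉ Module.support R (ExtMod R X N j) := by
  have h : (ModuleCat.ofHom (LinearMap.id : X →ₗ[R] X)) = 0 := by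
    ext x; exact Subsingleton.elim _ _
  rw [Module.notMem_support_iff']
  refine fun x ↦ ⟨1, p.asIdeal.one_notMem, ?_⟩
  have h2 : (Abelian.Ext.mk₀ (ModuleCat.ofHom (LinearMap.id : X →ₗ[R] X))).comp x
      (zero_add j) = x :=
    Abelian.Ext.mk₀_id_comp x
  rw [one_smul, ← h2, h, Abelian.Ext.mk₀_zero, Abelian.Ext.zero_comp]

variable {K} in
/-- The inductive step of `ExtMod.notMem_support_of_support_subset`: a bound on the vanishing at
`p` in lower degrees passes to degree `j`, by Noetherian induction on an ideal killing `X`. -/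
theorem ExtMod.notMem_support_of_lt {p : PrimeSpectrum R} {j : ℕ}
    (hK : p ∉ Module.support R (ExtMod R K N j))
    (hlt : ∀ k < j, ∀ (X : Type v) [AddCommGroup X] [Module R X] [Module.Finite R X],
      Module.support R X ⊆ Module.support R K → p ∉ Module.support R (ExtMod R X N k))
    (J : Ideal R) : ∀ (X : Type v) [AddCommGroup X] [Module R X] [Module.Finite R X],
      J ≤ Module.annihilator R X → Module.support R X ⊆ Module.support R K →
        p ∉ Module.support R (ExtMod R X N j) := by
  induction J using WellFoundedGT.induction with
  | _ J ih =>
  intro X _ _ hX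
  induction hX using IsNoetherianRing.induction_on_isQuotientEquivQuotientPrime R with
  | subsingleton X => exact fun _ _ ↦ ExtMod.notMem_support_of_subsingleton N X p j
  | exact X₁ X₂ X₃ f g hf hg hfg h₁ h₃ =>
    intro hJ hs
    exact ExtMod.notMem_support_middle hf hg hfg N
      (h₁ (hJ.trans (f.annihilator_le_of_injective hf))
        ((Module.support_subset_of_injective f hf).trans hs))
      (h₃ (hJ.trans (g.annihilator_le_of_surjective hg))
        ((Module.support_subset_of_surjective g hg).trans hs))
  | quotient X q e =>
    intro hJ hs
    have hann : Module.annihilator R X = q.asIdeal := by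
      rw [e.annihilator_eq, Ideal.annihilator_quotient]
    rw [hann] at hJ
    rcases hJ.lt_or_eq with hlt' | rfl
    · exact ih _ hlt' X hann.ge hs
    have hq : q ∈ Module.support R K := hs (Module.mem_support_iff_of_finite.2 hann.le)
    have := Module.finitePresentation_of_finite R K
    obtain ⟨φ, hφ⟩ := Module.exists_hom_quotient_ne_zero_of_mem_support hq
    let ψ : K →ₗ[R] X := e.symm.toLinearMap ∘ₗ φ
    obtain ⟨k, hk⟩ : ∃ k, φ k ≠ 0 := by
      by_contra! h
      exact hφ (LinearMap.ext h)
    -- The image of `ψ` is a quotient of `K`, and the kernel matters only in degrees below `j`,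
    -- where `hlt` applies.
    have hrange : p ∉ Module.support R (ExtMod R ψ.range N j) := by
      refine ExtMod.notMem_support_right (LinearMap.ker ψ).injective_subtype
        ψ.surjective_rangeRestrict (fun x ↦ ?_) N (fun i hi ↦ hlt i hi _ ?_) hK
      · simp [Subtype.ext_iff]
      · exact Module.support_subset_of_injective _ (LinearMap.ker ψ).injective_subtype
    refine ExtMod.notMem_support_middle (LinearMap.range ψ).injective_subtype
      (LinearMap.range ψ).mkQ_surjective (LinearMap.exact_subtype_mkQ _) N hrange ?_
    refine ih (Module.annihilator R (X ⧸ LinearMap.range ψ)) ?_ _ le_rfl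
      ((Module.support_subset_of_surjective _ (LinearMap.range ψ).mkQ_surjective).trans hs)
    refine lt_of_le_of_ne (hann.ge.trans
      ((LinearMap.range ψ).mkQ.annihilator_le_of_surjective (Submodule.mkQ_surjective _))) ?_
    -- A lift `r` of `φ k ≠ 0` lies outside `q` but kills the cokernel, so the annihilator grows
    -- strictly.
    obtain ⟨r, hr⟩ := Ideal.Quotient.mk_surjective (φ k)
    intro heq
    have hrq : r ∉ q.asIdeal := fun h ↦ hk (by rw [← hr, Ideal.Quotient.eq_zero_iff_mem.2 h])
    apply hrq
    rw [heq, Module.mem_annihilator]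
    intro y
    obtain ⟨x, rfl⟩ := Submodule.mkQ_surjective _ y
    rw [← map_smul, Submodule.mkQ_apply, Submodule.Quotient.mk_eq_zero]
    obtain ⟨t, ht⟩ := Ideal.Quotient.mk_surjective (e x)
    -- In `R/q`, both `e (ψ (t • k))` and `e (r • x)` are the product of the classes of `t` and `r`.
    refine ⟨t • k, e.injective ?_⟩
    simp only [ψ, map_smul, LinearMap.comp_apply, LinearEquiv.coe_coe, e.apply_symm_apply,
      ← hr, ← ht, Algebra.smul_def, Ideal.Quotient.algebraMap_eq, mul_comm]

/-- If `Ext^k(K, N)` vanishes at `p` for all `k ≤ j`, then so does `Ext^j(X, N)` for every finite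
`X` supported on the support of `K`. -/
theorem ExtMod.notMem_support_of_support_subset {p : PrimeSpectrum R} (j : ℕ)
    (hK : ∀ k ≤ j, p ∉ Module.support R (ExtMod R K N k)) (X : Type v) [AddCommGroup X]
    [Module R X] [Module.Finite R X] (hX : Module.support R X ⊆ Module.support R K) :
    p ∉ Module.support R (ExtMod R X N j) := by
  induction j using Nat.strong_induction_on generalizing X with
  | _ j ih =>
  exact ExtMod.notMem_support_of_lt N (hK j le_rfl)
    (fun k hk X _ _ _ hX ↦ ih k hk (fun l hl ↦ hK l (hl.trans hk.le)) X hX) ⊥ X bot_le hX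

end Noetherian

/-! ### Passing to and from the direct limit -/

section LocalCohomology

variable {R : Type u} [CommRing R] [IsNoetherianRing R] [Small.{v} R] (I : Ideal R)
  (M N : Type v) [AddCommGroup M] [Module R M] [Module.Finite R M]
  [AddCommGroup N] [Module R N]

omit [IsNoetherianRing R] [Small.{v} R] in
theorem support_quotient_pow_smul_subset (n : ℕ) :
    Module.support R (M ⧸ (I ^ n • ⊤ : Submodule R M)) ⊆
      Module.support R (M ⧸ (I • ⊤ : Submodule R M)) := by
  rw [Module.support_quotient, Module.support_quotient]
  rcases n.eq_zero_or_pos with rfl | hn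
  · simp [Ideal.one_eq_top]
  · rw [PrimeSpectrum.zeroLocus_pow I hn.ne']

theorem notMem_support_genLocalCohomology {p : PrimeSpectrum R} (j : ℕ)
    (h : ∀ k ≤ j, p ∉ Module.support R (ExtMod R (M ⧸ (I • ⊤ : Submodule R M)) N k)) :
    p ∉ Module.support R (genLocalCohomology I M N j) := by
  rw [Module.notMem_support_iff']
  intro z
  obtain ⟨n, x, rfl⟩ := Module.DirectLimit.exists_of z
  obtain ⟨r, hr, hrx⟩ := Module.notMem_support_iff'.1
    (ExtMod.notMem_support_of_support_subset _ N j h _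
      (support_quotient_pow_smul_subset I M n)) x
  exact ⟨r, hr, by rw [← map_smul, hrx, map_zero]⟩

theorem notMem_support_ext_of_genLocalCohomology {p : PrimeSpectrum R} (j : ℕ)
    (h : ∀ k ≤ j, p ∉ Module.support R (genLocalCohomology I M N k)) :
    p ∉ Module.support R (ExtMod R (M ⧸ (I • ⊤ : Submodule R M)) N j) := by
  induction j using Nat.strong_induction_on with
  | _ j ih =>
  have hlt : ∀ k < j, p ∉ Module.support R (ExtMod R (M ⧸ (I • ⊤ : Submodule R M)) N k) :=
    fun k hk ↦ ih k hk fun l hl ↦ h l (hl.trans hk.le)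
  -- This makes `M/IM` the term of index 1 in the directed system.
  rw [← pow_one I, Module.notMem_support_iff']
  intro x
  obtain ⟨r, hr, hrx⟩ := Module.notMem_support_iff'.1 (h j le_rfl)
    (Module.DirectLimit.of R ℕ _ (extTransition I M N j) 1 x)
  rw [← map_smul] at hrx
  obtain ⟨n, hn, hnx⟩ := Module.DirectLimit.of.zero_exact hrx
  have hsurj : Function.Surjective (powProj I M hn) := Submodule.factor_surjective
    (Submodule.smul_mono_left (Ideal.pow_le_pow_right hn))
  obtain ⟨s, hs, hsx⟩ := ExtMod.exists_smul_eq_zero_of_precomp_eq_zero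
    (LinearMap.ker (powProj I M hn)).injective_subtype hsurj
    (LinearMap.exact_subtype_ker_map _) N
    (fun k hk ↦ ExtMod.notMem_support_of_support_subset _ N k
      (fun l hl ↦ hlt l (hl.trans_lt hk)) _
      ((Module.support_subset_of_injective _
        (LinearMap.ker (powProj I M hn)).injective_subtype).trans
        (support_quotient_pow_smul_subset I M n))) hnx
  exact ⟨s * r, p.asIdeal.primeCompl.mul_mem hs hr, by rwa [mul_smul]⟩

end LocalCohomology

end GenLocCoh

theorem lemma2p8 (R : Type u) [CommRing R] [IsNoetherianRing R] [IsLocalRing R]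
    [Small.{v} R] (I : Ideal R) (M N : Type v)
    [AddCommGroup M] [Module R M] [Module.Finite R M]
    [AddCommGroup N] [Module R N] [Module.Finite R N] (i : ℕ∞) :
    (⋃ (j : ℕ) (_ : (j : ℕ∞) < i),
        Module.support R (GenLocCoh.genLocalCohomology I M N j)) =
      ⋃ (j : ℕ) (_ : (j : ℕ∞) < i),
        Module.support R (GenLocCoh.ExtMod R (M ⧸ (I • ⊤ : Submodule R M)) N j) := by
  ext p
  rw [← not_iff_not]
  simp only [Set.mem_iUnion, not_exists]
  have hle {k j : ℕ} (hkj : k ≤ j) (hj : (j : ℕ∞) < i) : (k : ℕ∞) < i :=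
    (Nat.cast_le.2 hkj).trans_lt hj
  exact ⟨fun h j hj ↦ GenLocCoh.notMem_support_ext_of_genLocalCohomology I M N j
      fun k hk ↦ h k (hle hk hj),
    fun h j hj ↦ GenLocCoh.notMem_support_genLocalCohomology I M N j
      fun k hk ↦ h k (hle hk hj)⟩
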